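/- Let $V$ be a real vector space and let $P:V\to\mathbb R$ be a homogeneous polynomial of degree $k$, i.e. $P(x)=M(x,\dots,x)$ for some $k$-linear form $M$ on $V$. Suppose that $P$ is hyperbolic with respect to $e\in V$: $P(e)>0$ and, for every $x\in V$, the univariate polynomial $t\mapsto P(te+x)$ has only real zeros. Write $P(te+x)=P(e)\prod_{i=1}^k\bigl(t+\lambda_i(P;e,x)\bigr)$ with real numbers $\lambda_i(P;e,x)$, and let $$\Gamma(P;e)=\{x\in V:\ \lambda_i(P;e,x)>0\ \text{for all } i=1,\dots,k\}$$ be the hyperbolicity cone. Let a finite group $G$ act linearly on $V$ so that $g\cdot e=e$ for all $g\in G$, and $P(g\cdot x)=P(x)$ for all $g\in G$ and $x\in V$. Put $\mathrm{Rey}_G(x)=\frac1{|G|}\sum_{g\in G}g\cdot x$. Then, for every $x\in\Gamma(P;e)$: (a) $g\cdot x\in\Gamma(P;e)$ for all $g\in G$, and $\mathrm{Rey}_G(x)\in\Gamma(P;e)$; (b) $P(\mathrm{Rey}_G(x))\ge P(x)$. Equivalently, if $k\ge1$, the function $P^{1/k}$, which is concave on the convex set $\Gamma(P;e)$, satisfies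 $P(\mathrm{Rey}_G(x))^{1/k}\ge P(x)^{1/k}$. -/

import Mathlib

namespace HyperbolicPoly

/-- `P : V → ℝ` is a homogeneous polynomial of degree `k` on the real vector space `V`: it is the
restriction to the diagonal of a `k`-linear form.  In coordinates of a finite-dimensional `V` these
are exactly the functions given by homogeneous polynomials of degree `k`; no basis and no
finiteness of the dimension is needed. -/
def IsHomogeneousPolynomial {V : Type*} [AddCommGroup V] [Module ℝ V]
    (k : ℕ) (P : V → ℝ) : Prop :=
  ∃ m : MultilinearMap ℝ (fun _ : Fin k => V) ℝ, ∀ x : V, P x = m (fun _ => x)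

/-- `P` is a homogeneous polynomial of degree `k` that is hyperbolic with respect to `e`:
`P e > 0` and, for every `x`, the univariate real polynomial `q(t) = P (t e + x)` has only real
zeros, that is, each of its complex zeros is real. -/
structure IsHyperbolic {V : Type*} [AddCommGroup V] [Module ℝ V]
    (k : ℕ) (P : V → ℝ) (e : V) : Prop where
  homogeneous : IsHomogeneousPolynomial k P
  pos : 0 < P e
  real_zeros : ∀ x : V, ∃ q : Polynomial ℝ, (∀ t : ℝ, q.eval t = P (t • e + x)) ∧
    ∀ z : ℂ, Polynomial.aeval z q = 0 → z.im = 0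

/-- `μ` is an `e`-eigenvalue of `x`, that is, one of the numbers `μᵢ` in the factorization
`P (t e + x) = P e * ∏ᵢ (t + μᵢ)`: equivalently, `-μ` is a zero of `t ↦ P (t e + x)`. -/
def IsEigenvalue {V : Type*} [AddCommGroup V] [Module ℝ V]
    (P : V → ℝ) (e x : V) (μ : ℝ) : Prop :=
  P ((-μ) • e + x) = 0

/-- The hyperbolicity (Gårding) cone `Γ(P; e)`: all `e`-eigenvalues of `x` are positive. -/
def cone {V : Type*} [AddCommGroup V] [Module ℝ V] (P : V → ℝ) (e : V) : Set V :=
  {x | ∀ μ : ℝ, IsEigenvalue P e x μ → 0 < μ}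

/-- The Reynolds operator (group average) of a linear action of a finite group. -/
noncomputable def reynolds {G V : Type*} [Group G] [Fintype G] [AddCommGroup V] [Module ℝ V]
    (ρ : Representation ℝ G V) : V →ₗ[ℝ] V :=
  (1 / (Fintype.card G : ℝ)) • ∑ g : G, ρ g

end HyperbolicPoly

/-! The substance is Gårding's theorem: the cone is convex and `P ^ (1 / k)` is concave on it. The
rest is Jensen's inequality: the group average is a convex combination of orbit points, which lie in
the cone because `P` and `e` are invariant, and `P` is constant on the orbit.

For `a`, `b` in the cone, let `F(z, t, s)` be the complex polynomial extending `P (z e + t a + s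
b)`. Moving zeros cannot enter a half-plane without crossing its boundary line
(`ne_zero_of_continuation`), where hyperbolicity along `e` excludes them. This gives first that `t ↦
P (t a + b)` has only real zeros (`im_eq_zero_of_mem_cone`), then that `P (a + b) ≠ 0`
(`add_ne_zero`). Shifts along `e` and positive scalings turn the latter into convexity. It also
makes the zeros of `P (t a + b)` negative, so that `P (t a + b) = P a * ∏ (t + μ i)` with `μ i > 0`;
AM-GM at `t = 1` then makes `P ^ (1 / k)` superadditive, hence concave by homogeneity. -/

namespace HyperbolicPoly

open Polynomial Filter Topology

/-! ### Continuity of zeros -/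

section Continuation

/-- Factoring into linear terms bounds each factor below by `δ`. This is a quantitative Hurwitz
theorem: a small value at `τ` forces a zero near `τ`. -/
theorem norm_coeff_mul_pow_le_norm_eval {k : ℕ} {p : ℂ[X]} (hdeg : p.natDegree ≤ k)
    (hc : p.coeff k ≠ 0) {τ : ℂ} {δ : ℝ} (hδ : 0 ≤ δ) (hroot : ∀ r, p.eval r = 0 → δ ≤ ‖τ - r‖) :
    ‖p.coeff k‖ * δ ^ k ≤ ‖p.eval τ‖ := by
  have hk : p.natDegree = k := le_antisymm hdeg (le_natDegree_of_ne_zero hc)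
  have hp : p ≠ 0 := by rintro rfl; simp at hc
  have hs := IsAlgClosed.splits p
  have hcard : p.roots.card = k := by rw [← hk]; exact hs.natDegree_eq_card_roots.symm
  have hev : p.eval τ = p.coeff k * (p.roots.map fun r => τ - r).prod := by
    conv_lhs => rw [hs.eq_prod_roots]
    rw [eval_mul, eval_C, eval_multiset_prod, Multiset.map_map, leadingCoeff, hk]
    simp
  rw [hev, norm_mul]
  gcongr
  rw [← hcard]
  have : ∀ s : Multiset ℂ, (∀ r ∈ s, δ ≤ ‖τ - r‖) →
      δ ^ s.card ≤ ‖(s.map fun r => τ - r).prod‖ := by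
    intro s
    induction s using Multiset.induction_on with
    | empty => simp
    | cons a s ih =>
      intro h
      rw [Multiset.card_cons, Multiset.map_cons, Multiset.prod_cons, norm_mul, pow_succ, mul_comm]
      gcongr
      · exact h a (Multiset.mem_cons_self a s)
      · exact ih fun r hr => h r (Multiset.mem_cons_of_mem hr)
  exact this _ fun r hr => hroot r ((mem_roots hp).1 hr)

variable {E : Type*} [NormedAddCommGroup E] [NormedSpace ℂ E]

/-- Zeros of a homogeneous polynomial on a moving line do not enter an open set `U` if they never
meet its frontier. -/
theorem ne_zero_of_continuation {k : ℕ} {F : E → ℂ} (hF : Continuous F)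
    (hhom : ∀ (c : ℂ) (z : E), F (c • z) = c ^ k * F z)
    (hline : ∀ v w : E, ∃ p : ℂ[X], p.natDegree ≤ k ∧ p.coeff k = F w ∧
      ∀ t, p.eval t = F (v + t • w))
    {v y w : E} (hw : F w ≠ 0) {U : Set ℂ} (hU : IsOpen U)
    (hfr : ∀ s ∈ Set.Icc (0 : ℝ) 1, ∀ t ∈ frontier U, F (v + (s : ℂ) • y + t • w) ≠ 0)
    (h0 : ∀ t ∈ U, F (v + t • w) ≠ 0) :
    ∀ t ∈ U, F (v + y + t • w) ≠ 0 := by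
  let g : unitInterval × ℂ → ℂ := fun q => F (v + ((q.1 : ℝ) : ℂ) • y + q.2 • w)
  have hg : Continuous g := by fun_prop
  -- a uniform bound for the zeros
  obtain ⟨R, hR⟩ : ∃ R : ℝ, ∀ s : unitInterval, ∀ t : ℂ, g (s, t) = 0 → ‖t‖ ≤ R := by
    have h1 : ∀ᶠ z in 𝓝 w, F z ≠ 0 := hF.continuousAt.eventually_ne hw
    obtain ⟨δ, hδ, hball⟩ := Metric.eventually_nhds_iff.1 h1
    refine ⟨(‖v‖ + ‖y‖) / δ + 1, fun s t ht => ?_⟩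
    by_contra! hlt
    have hq : 0 ≤ (‖v‖ + ‖y‖) / δ := by positivity
    have htpos : 0 < ‖t‖ := by linarith
    have ht0 : t ≠ 0 := norm_pos_iff.1 htpos
    have hs : ‖((s : ℝ) : ℂ) • y‖ ≤ ‖y‖ := by
      rw [norm_smul, Complex.norm_real, Real.norm_of_nonneg s.2.1]
      exact mul_le_of_le_one_left (norm_nonneg _) s.2.2
    have hlt' : ‖v‖ + ‖y‖ < δ * ‖t‖ := by
      have : (‖v‖ + ‖y‖) / δ < ‖t‖ := by linarith
      rwa [div_lt_iff₀' hδ] at this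
    -- Dividing by `t` turns a zero with large `t` into a zero of `F` close to `w`, where there is
    -- none.
    refine hball (y := t⁻¹ • (v + ((s : ℝ) : ℂ) • y + t • w)) ?_ ?_
    · rw [smul_add _ _ (t • w), inv_smul_smul₀ ht0, dist_eq_norm, add_sub_cancel_right, norm_smul,
        norm_inv, inv_mul_lt_iff₀ htpos]
      calc _ ≤ ‖v‖ + ‖((s : ℝ) : ℂ) • y‖ := norm_add_le _ _
        _ < _ := by rw [mul_comm]; linarith
    · rw [hhom]
      have : F (v + ((s : ℝ) : ℂ) • y + t • w) = 0 := ht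
      rw [this, mul_zero]
  -- The bad parameters form a clopen subset of a connected interval that omits `0`. Closedness uses
  -- the bound `R` and the absence of zeros on the frontier; openness uses the fixed leading
  -- coefficient `F w`.
  let S : Set unitInterval := {s | ∃ t ∈ U, g (s, t) = 0}
  have hSclosed : IsClosed S := by
    have hK : IsCompact (closure U ∩ Metric.closedBall (0 : ℂ) R) :=
      (isCompact_closedBall 0 R).inter_left isClosed_closure
    have : S = Prod.fst '' ((Set.univ ×ˢ (closure U ∩ Metric.closedBall (0 : ℂ) R)) ∩ g ⁻¹' {0}) := by
      ext s
      constructor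
      · rintro ⟨t, htU, ht⟩
        exact ⟨(s, t), ⟨⟨trivial, subset_closure htU, by simpa using hR s t ht⟩, ht⟩, rfl⟩
      · rintro ⟨⟨s', t⟩, ⟨⟨-, htU, -⟩, ht⟩, rfl⟩
        refine ⟨t, ?_, ht⟩
        by_contra hn
        exact hfr s' s'.2 t ⟨htU, by rwa [hU.interior_eq]⟩ ht
    rw [this]
    exact (((isCompact_univ.prod hK).inter_right
      (isClosed_singleton.preimage hg)).image continuous_fst).isClosed
  have hSopen : IsOpen S := by
    rw [isOpen_iff_mem_nhds]
    rintro s ⟨τ, hτ, hs⟩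
    obtain ⟨δ, hδ, hball⟩ := Metric.isOpen_iff.1 hU τ hτ
    have hcont : Continuous fun s' : unitInterval => ‖g (s', τ)‖ := by fun_prop
    have hlt : ‖g (s, τ)‖ < ‖F w‖ * δ ^ k := by
      rw [hs, norm_zero]
      have := norm_pos_iff.2 hw
      positivity
    filter_upwards [hcont.continuousAt.eventually_lt_const hlt] with s' hs'
    obtain ⟨p, hdeg, hcoeff, hev⟩ := hline (v + ((s' : ℝ) : ℂ) • y) w
    by_contra hno
    have := norm_coeff_mul_pow_le_norm_eval hdeg (by rwa [hcoeff]) hδ.le (τ := τ) (by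
      intro r hr
      by_contra! hlt'
      refine hno ⟨r, hball ?_, (hev r).symm.trans hr⟩
      rwa [Metric.mem_ball, dist_comm, dist_eq_norm])
    rw [hcoeff, hev] at this
    exact absurd hs' (not_lt.2 this)
  have hzero : (0 : unitInterval) ∉ S := by
    rintro ⟨t, ht, h⟩
    exact h0 t ht (by simpa [g] using h)
  have hS : S = ∅ := by
    rcases isClopen_iff.1 ⟨hSclosed, hSopen⟩ with h | h
    · exact h
    · exact absurd (h ▸ Set.mem_univ _) hzero
  intro t ht h
  have : (1 : unitInterval) ∈ S := ⟨t, ht, by simpa [g] using h⟩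
  simp [hS] at this

end Continuation

/-! ### Complexification of a homogeneous polynomial -/

section ComplexExtension

variable {V : Type*} [AddCommGroup V] [Module ℝ V] {k : ℕ}

/-- The values of `x ↦ m (x, …, x)` at complex linear combinations `∑ z i • v i`. -/
noncomputable def complexExt {ι : Type*} [Fintype ι] (m : MultilinearMap ℝ (fun _ : Fin k => V) ℝ)
    (v : ι → V) (z : ι → ℂ) : ℂ :=
  ∑ r : Fin k → ι, (∏ i, z (r i)) * (m (fun i => v (r i)) : ℂ)

variable {ι : Type*} [Fintype ι] (m : MultilinearMap ℝ (fun _ : Fin k => V) ℝ) (v : ι → V)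

theorem complexExt_ofReal (x : ι → ℝ) :
    complexExt m v (fun i => (x i : ℂ)) = (m (fun _ => ∑ i, x i • v i) : ℂ) := by
  classical
  rw [m.map_sum]
  simp [complexExt, m.map_smul_univ]

theorem continuous_complexExt : Continuous (complexExt m v) := by
  unfold complexExt
  fun_prop

theorem complexExt_smul (c : ℂ) (z : ι → ℂ) :
    complexExt m v (c • z) = c ^ k * complexExt m v z := by
  simp [complexExt, Finset.prod_mul_distrib, Finset.mul_sum, mul_assoc]

theorem exists_polynomial_complexExt_line (z w : ι → ℂ) :
    ∃ p : ℂ[X], p.natDegree ≤ k ∧ p.coeff k = complexExt m v w ∧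
      ∀ t, p.eval t = complexExt m v (z + t • w) := by
  have hlin : ∀ i : ι, (C (w i) * X + C (z i)).natDegree ≤ 1 := fun i => natDegree_linear_le
  refine ⟨∑ r : Fin k → ι, (∏ i, (C (w (r i)) * X + C (z (r i)))) *
    C (m (fun i => v (r i)) : ℂ), ?_, ?_, ?_⟩
  · refine natDegree_sum_le_of_forall_le _ _ fun r _ => (natDegree_mul_C_le _ _).trans ?_
    refine (natDegree_prod_le _ _).trans ?_
    exact (Finset.sum_le_sum fun i _ => hlin (r i)).trans (by simp)
  · rw [finsetSum_coeff, complexExt]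
    refine Finset.sum_congr rfl fun r _ => ?_
    rw [coeff_mul_C]
    have := coeff_prod_of_natDegree_le (s := Finset.univ)
      (fun i : Fin k => C (w (r i)) * X + C (z (r i))) 1 fun i _ => hlin (r i)
    simp only [Finset.card_univ, Fintype.card_fin, mul_one] at this
    rw [this]
    simp
  · intro t
    rw [eval_finsetSum, complexExt]
    refine Finset.sum_congr rfl fun r _ => ?_
    rw [eval_mul, eval_prod, eval_C]
    congr 1
    refine Finset.prod_congr rfl fun i _ => ?_
    simp only [eval_add, eval_mul, eval_C, eval_X, Pi.add_apply, Pi.smul_apply, smul_eq_mul]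
    ring

end ComplexExtension

/-! ### Gårding's theorem on the hyperbolicity cone -/

section Garding

variable {V : Type*} [AddCommGroup V] [Module ℝ V] {k : ℕ} {P : V → ℝ} {e : V}
  {m : MultilinearMap ℝ (fun _ : Fin k => V) ℝ}

theorem complexExt_triple_ofReal (hm : ∀ x, P x = m fun _ => x) (a b : V) (x y z : ℝ) :
    complexExt m ![e, a, b] ![(x : ℂ), (y : ℂ), (z : ℂ)] = (P (x • e + y • a + z • b) : ℂ) := by
  have := complexExt_ofReal m ![e, a, b] ![x, y, z]
  rw [Fin.sum_univ_three] at this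
  rw [hm]
  convert this using 2
  ext i
  · fin_cases i <;> rfl
  · rfl

theorem complexExt_triple_smul (a b : V) (c x y z : ℂ) :
    complexExt m ![e, a, b] ![c * x, c * y, c * z] = c ^ k * complexExt m ![e, a, b] ![x, y, z] := by
  rw [← complexExt_smul]
  simp

theorem IsHomogeneousPolynomial.map_smul (h : IsHomogeneousPolynomial k P) (c : ℝ) (x : V) :
    P (c • x) = c ^ k * P x := by
  obtain ⟨m, hm⟩ := h
  rw [hm, hm, m.map_smul_univ (fun _ => c) fun _ => x]
  simp

theorem ne_zero_of_mem_cone {a : V} (ha : a ∈ cone P e) : P a ≠ 0 := fun h =>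
  lt_irrefl 0 (ha 0 (by simpa [IsEigenvalue] using h))

theorem add_smul_mem_cone {a : V} (ha : a ∈ cone P e) {c : ℝ} (hc : 0 ≤ c) :
    a + c • e ∈ cone P e := by
  intro μ hμ
  have : IsEigenvalue P e a (μ - c) := by
    rw [IsEigenvalue] at hμ ⊢
    rw [← hμ]
    congr 1
    module
  linarith [ha _ this]

namespace IsHyperbolic

variable (hP : IsHyperbolic k P e)

include hP

theorem im_eq_zero_of_complexExt_eq_zero (hm : ∀ x, P x = m fun _ => x) {a b : V} {z : ℂ} {y s : ℝ}
    (hz : complexExt m ![e, a, b] ![z, (y : ℂ), (s : ℂ)] = 0) : z.im = 0 := by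
  obtain ⟨q, hq, hroots⟩ := hP.real_zeros (y • a + s • b)
  obtain ⟨p, -, -, hp⟩ := exists_polynomial_complexExt_line m ![e, a, b]
    ![0, (y : ℂ), (s : ℂ)] ![1, 0, 0]
  have hp' : ∀ t, p.eval t = complexExt m ![e, a, b] ![t, (y : ℂ), (s : ℂ)] := by
    intro t
    rw [hp]
    simp
  -- Both polynomials agree at every real point.
  have hpq : p = q.map (algebraMap ℝ ℂ) := by
    refine Polynomial.eq_of_infinite_eval_eq _ _
      ((Set.infinite_range_of_injective Complex.ofReal_injective).mono ?_)
    rintro _ ⟨t, rfl⟩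
    change p.eval (t : ℂ) = (q.map (algebraMap ℝ ℂ)).eval (algebraMap ℝ ℂ t)
    rw [hp', eval_map_algebraMap, aeval_algebraMap_apply, coe_aeval_eq_eval, hq,
      complexExt_triple_ofReal hm, add_assoc]
    rfl
  refine hroots z ?_
  rw [← eval_map_algebraMap, ← hpq, hp', hz]

theorem eigenvalues_finite (a : V) : {μ | IsEigenvalue P e a μ}.Finite := by
  obtain ⟨q, hq, hroots⟩ := hP.real_zeros a
  -- The zero polynomial would have the nonreal zero `I`.
  have hq0 : q ≠ 0 := by
    rintro rfl
    simpa using hroots Complex.I (by simp)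
  refine ((q.rootSet_finite ℝ).preimage (f := fun μ : ℝ => -μ) neg_injective.injOn).subset ?_
  intro μ hμ
  rw [Set.mem_preimage, mem_rootSet]
  exact ⟨hq0, by rw [coe_aeval_eq_eval, hq]; exact hμ⟩

/-- There are finitely many eigenvalues. The margin `ε` lets `a - ε e` replace `a` in the
deformations below. -/
theorem exists_pos_lt_eigenvalues {a : V} (ha : a ∈ cone P e) :
    ∃ ε : ℝ, 0 < ε ∧ ∀ μ, IsEigenvalue P e a μ → ε < μ := by
  have h : ∀ᶠ ε in 𝓝[>] (0 : ℝ), ∀ μ ∈ {μ | IsEigenvalue P e a μ}, ε < μ :=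
    (eventually_all_finite (hP.eigenvalues_finite a)).2 fun μ hμ =>
      (eventually_lt_nhds (ha μ hμ)).filter_mono nhdsWithin_le_nhds
  obtain ⟨ε, hε, hpos⟩ := (h.and self_mem_nhdsWithin).exists
  exact ⟨ε, hpos, hε⟩

/-- By homogeneity `z / t` is a zero of `P (· e + a)`, hence real. -/
theorem exists_eigenvalue_of_complexExt_left (hm : ∀ x, P x = m fun _ => x) {a b : V} {z t : ℂ}
    (ht : t ≠ 0) (hz : complexExt m ![e, a, b] ![z, t, 0] = 0) :
    ∃ μ : ℝ, IsEigenvalue P e a μ ∧ z = -μ * t := by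
  have h1 : complexExt m ![e, a, b] ![t⁻¹ * z, ((1 : ℝ) : ℂ), ((0 : ℝ) : ℂ)] = 0 := by
    have := complexExt_triple_smul (m := m) (e := e) a b t⁻¹ z t 0
    rw [hz, mul_zero, mul_zero, inv_mul_cancel₀ ht] at this
    simpa using this
  have him := hP.im_eq_zero_of_complexExt_eq_zero hm h1
  have hre : t⁻¹ * z = (((t⁻¹ * z).re : ℝ) : ℂ) := Complex.ext rfl (by simpa using him)
  rw [hre, complexExt_triple_ofReal hm] at h1
  refine ⟨-(t⁻¹ * z).re, ?_, ?_⟩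
  · rw [IsEigenvalue]
    simpa using h1
  · rw [Complex.ofReal_neg, ← hre]
    field_simp

theorem exists_eigenvalue_of_complexExt_right (hm : ∀ x, P x = m fun _ => x) {a b : V} {z t : ℂ}
    (ht : t ≠ 0) (hz : complexExt m ![e, a, b] ![z, 0, t] = 0) :
    ∃ μ : ℝ, IsEigenvalue P e b μ ∧ z = -μ * t := by
  have h1 : complexExt m ![e, a, b] ![t⁻¹ * z, ((0 : ℝ) : ℂ), ((1 : ℝ) : ℂ)] = 0 := by
    have := complexExt_triple_smul (m := m) (e := e) a b t⁻¹ z 0 t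
    rw [hz, mul_zero, mul_zero, inv_mul_cancel₀ ht] at this
    simpa using this
  have him := hP.im_eq_zero_of_complexExt_eq_zero hm h1
  have hre : t⁻¹ * z = (((t⁻¹ * z).re : ℝ) : ℂ) := Complex.ext rfl (by simpa using him)
  rw [hre, complexExt_triple_ofReal hm] at h1
  refine ⟨-(t⁻¹ * z).re, ?_, ?_⟩
  · rw [IsEigenvalue]
    simpa using h1
  · rw [Complex.ofReal_neg, ← hre]
    field_simp

/-- Deform the coefficient of `b` from `0` to `s` and follow the zeros `t` in the upper half-plane.
For real `t` the last two coordinates are real while the first is not, contrary to hyperbolicity. At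
the start, a zero satisfies `z = -(μ - ε) t` with `μ > ε`, so `z` and `t` cannot both have positive
imaginary part. -/
theorem complexExt_ne_zero_of_im_pos (hm : ∀ x, P x = m fun _ => x) {a b : V} {ε : ℝ}
    (ha : ∀ μ, IsEigenvalue P e a μ → ε < μ) {z t : ℂ} (hz : 0 < z.im) (ht : 0 ≤ t.im) (s : ℝ) :
    complexExt m ![e, a, b] ![z - ε * t, t, (s : ℂ)] ≠ 0 := by
  have hreal : ∀ (t : ℂ) (r : ℝ), t.im = 0 →
      complexExt m ![e, a, b] ![z - ε * t, t, (r : ℂ)] ≠ 0 := by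
    intro t r ht0 h
    obtain ⟨x, rfl⟩ : ∃ x : ℝ, t = x := ⟨t.re, Complex.ext rfl (by simpa using ht0)⟩
    have := hP.im_eq_zero_of_complexExt_eq_zero hm h
    simp at this
    exact hz.ne' this
  rcases ht.eq_or_lt with ht0 | ht
  · exact hreal t s ht0.symm
  have hvec : ∀ (r t : ℂ), ![z, 0, 0] + r • ![(0 : ℂ), 0, (s : ℂ)] + t • ![-(ε : ℂ), 1, 0] =
      ![z - ε * t, t, r * s] := by
    intro r t
    ext i
    fin_cases i <;> simp [sub_eq_add_neg, mul_comm]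
  have key := ne_zero_of_continuation (k := k) (continuous_complexExt m ![e, a, b])
    (complexExt_smul m _) (exists_polynomial_complexExt_line m _)
    (v := ![z, 0, 0]) (y := ![0, 0, (s : ℂ)]) (w := ![-(ε : ℂ), 1, 0]) ?_
    (U := {t : ℂ | 0 < t.im}) (isOpen_lt continuous_const Complex.continuous_im) ?_ ?_ t ht
  · have := hvec 1 t
    rw [one_smul, one_mul] at this
    rwa [this] at key
  -- The leading coefficient is `P (a - ε e)`, nonzero because `ε` lies strictly below all
  -- eigenvalues.
  · intro h
    have h2 := complexExt_triple_ofReal hm (e := e) a b (-ε) 1 0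
    simp only [Complex.ofReal_neg, Complex.ofReal_one, Complex.ofReal_zero, h, one_smul, zero_smul,
      add_zero] at h2
    exact lt_irrefl ε (ha ε (by exact_mod_cast h2.symm))
  · intro r _ t ht
    have ht0 : t.im = 0 := by
      have : t ∈ frontier {t : ℂ | 0 < t.im} := ht
      rw [Complex.frontier_setOfPred_lt_im] at this
      exact this
    rw [hvec, ← Complex.ofReal_mul]
    exact hreal t _ ht0
  · intro t ht h
    have := hvec 0 t
    rw [zero_smul, add_zero, zero_mul] at this
    rw [this] at h
    have ht0 : t ≠ 0 := by rintro rfl; simp at ht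
    obtain ⟨μ, hμ, hzt⟩ := hP.exists_eigenvalue_of_complexExt_left hm ht0 h
    have hμ := ha μ hμ
    have h3 : z = -((μ - ε : ℝ) : ℂ) * t := by
      push_cast
      linear_combination hzt
    have h4 : z.im = -(μ - ε) * t.im := by
      rw [h3, ← Complex.ofReal_neg, Complex.im_ofReal_mul]
    have ht : 0 < t.im := ht
    nlinarith [mul_pos (sub_pos.2 hμ) ht]

/-- The choice `z = ε t` in the previous lemma cancels the `e`-coordinate: `a` inherits the
real-rootedness of `e`. -/
theorem im_eq_zero_of_mem_cone (hm : ∀ x, P x = m fun _ => x) {a b : V} (ha : a ∈ cone P e)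
    {t : ℂ} (h : complexExt m ![e, a, b] ![0, t, 1] = 0) : t.im = 0 := by
  obtain ⟨ε, hε, ha⟩ := hP.exists_pos_lt_eigenvalues ha
  have key : ∀ (t : ℂ) (s : ℝ), 0 < t.im → complexExt m ![e, a, b] ![0, t, (s : ℂ)] ≠ 0 := by
    intro t s ht
    have := hP.complexExt_ne_zero_of_im_pos hm (b := b) ha (z := ε * t) (t := t)
      (by rw [Complex.im_ofReal_mul]; positivity) ht.le s
    rwa [sub_self] at this
  rcases lt_trichotomy t.im 0 with ht | ht | ht
  -- Multiplication by `-1` exchanges the half-planes; this is why `key` allows any real `s`.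
  · refine absurd ?_ (key (-t) (-1) (by simpa using ht))
    have := complexExt_triple_smul (m := m) (e := e) a b (-1) 0 t 1
    rw [h, mul_zero] at this
    simpa using this
  · exact ht
  · exact absurd (by simpa using h) (key t 1 ht)

/-- Deform `ε e` into `a` along `ε (1 - s) e + s a`, following the zeros `t` of `P (· + t b)` in the
right half-plane. At `s = 0` they satisfy `ε = -μ t` with `μ > 0`, so `t` has negative real part; at
`s = 1` the value `t = 1` gives `P (a + b)`. -/
theorem add_ne_zero {a b : V} (ha : a ∈ cone P e) (hb : b ∈ cone P e) : P (a + b) ≠ 0 := by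
  obtain ⟨m, hm⟩ := hP.homogeneous
  obtain ⟨ε, hε, ha⟩ := hP.exists_pos_lt_eigenvalues ha
  have hvec : ∀ (s t : ℂ), ![(ε : ℂ), 0, 0] + s • ![-(ε : ℂ), 1, 0] + t • ![(0 : ℂ), 0, 1] =
      ![ε - ε * s, s, t] := by
    intro s t
    ext i
    fin_cases i <;> simp [sub_eq_add_neg, mul_comm]
  have key := ne_zero_of_continuation (k := k) (continuous_complexExt m ![e, a, b])
    (complexExt_smul m _) (exists_polynomial_complexExt_line m _)
    (v := ![(ε : ℂ), 0, 0]) (y := ![-(ε : ℂ), 1, 0]) (w := ![0, 0, 1]) ?_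
    (U := {t : ℂ | 0 < t.re}) (isOpen_lt continuous_const Complex.continuous_re) ?_ ?_ 1
    (by simp)
  · have h1 := hvec 1 1
    rw [one_smul (M := ℂ) (b := ![-(ε : ℂ), 1, 0])] at h1
    rw [h1] at key
    have h2 := complexExt_triple_ofReal hm (e := e) a b 0 1 1
    intro h
    simp [h] at h2
    simp [h2] at key
  · intro h
    have h2 := complexExt_triple_ofReal hm (e := e) a b 0 0 1
    simp [h] at h2
    exact ne_zero_of_mem_cone hb (by exact_mod_cast h2.symm)
  · intro s hs t ht h
    have ht0 : t.re = 0 := by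
      have : t ∈ frontier {t : ℂ | 0 < t.re} := ht
      rw [Complex.frontier_setOfPred_lt_re] at this
      exact this
    rw [hvec] at h
    -- For `t` on the imaginary axis, multiplication by `I` makes the `b`-coordinate real, and
    -- `complexExt_ne_zero_of_im_pos` applies with `z = ε I` and `t = I s`.
    have h1 := complexExt_triple_smul (m := m) (e := e) a b Complex.I (ε - ε * s) s t
    rw [h, mul_zero] at h1
    have hI : Complex.I * t = ((-t.im : ℝ) : ℂ) := by
      apply Complex.ext <;> simp [ht0]
    have h2 := hP.complexExt_ne_zero_of_im_pos hm (b := b) ha (z := ε * Complex.I)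
      (t := Complex.I * s) (by simpa using hε) (by simpa using hs.1) (-t.im)
    rw [← hI] at h2
    refine h2 ?_
    rw [← h1]
    congr 2
    ring
  · intro t ht h
    have h1 := hvec 0 t
    rw [zero_smul, add_zero, mul_zero, sub_zero] at h1
    rw [h1] at h
    have ht : 0 < t.re := ht
    have ht0 : t ≠ 0 := by rintro rfl; simp at ht
    obtain ⟨μ, hμ, hzt⟩ := hP.exists_eigenvalue_of_complexExt_right hm ht0 h
    have h3 : ε = -μ * t.re := by
      have := congrArg Complex.re hzt
      rwa [← Complex.ofReal_neg, Complex.re_ofReal_mul, Complex.ofReal_re] at this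
    nlinarith [mul_pos (hb μ hμ) ht]

theorem smul_mem_cone {a : V} (ha : a ∈ cone P e) {c : ℝ} (hc : 0 < c) : c • a ∈ cone P e := by
  intro μ hμ
  have : IsEigenvalue P e a (c⁻¹ * μ) := by
    have h : P (c⁻¹ • ((-μ) • e + c • a)) = 0 := by
      rw [hP.homogeneous.map_smul, show P _ = 0 from hμ, mul_zero]
    rw [smul_add, inv_smul_smul₀ hc.ne', smul_smul] at h
    rwa [IsEigenvalue, neg_mul_eq_mul_neg]
  have := ha _ this
  rwa [mul_pos_iff_of_pos_left (inv_pos.2 hc)] at this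

theorem add_mem_cone {a b : V} (ha : a ∈ cone P e) (hb : b ∈ cone P e) : a + b ∈ cone P e := by
  intro μ hμ
  by_contra! hle
  -- An eigenvalue `μ ≤ 0` is absorbed by shifting `a` by `-μ e`, which stays in the cone.
  refine hP.add_ne_zero (add_smul_mem_cone ha (neg_nonneg.2 hle)) hb ?_
  rw [← show P _ = 0 from hμ]
  congr 1
  module

theorem convex_cone : Convex ℝ (cone P e) := by
  refine convex_iff_forall_pos.2 fun a ha b hb s t hs ht _ => ?_
  exact hP.add_mem_cone (hP.smul_mem_cone ha hs) (hP.smul_mem_cone hb ht)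

theorem self_mem_cone : e ∈ cone P e := by
  intro μ hμ
  by_contra! hle
  have h : P ((1 - μ) • e) = 0 := by
    rw [← show P _ = 0 from hμ]
    congr 1
    module
  rw [hP.homogeneous.map_smul] at h
  exact (mul_pos (pow_pos (by linarith) k) hP.pos).ne' h

/-- The zeros in `t` are real by `im_eq_zero_of_mem_cone`. A zero `r ≥ 0` is impossible: `b` and,
for `r > 0`, `r a + b` are not zeros of `P`. -/
theorem exists_factorization {a b : V} (ha : a ∈ cone P e) (hb : b ∈ cone P e) :
    ∃ μ : Fin k → ℝ, (∀ i, 0 < μ i) ∧ ∀ t : ℝ, P (t • a + b) = P a * ∏ i, (t + μ i) := by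
  obtain ⟨m, hm⟩ := hP.homogeneous
  obtain ⟨p, hdeg, hcoeff, hp⟩ := exists_polynomial_complexExt_line m ![e, a, b]
    ![0, 0, 1] ![0, 1, 0]
  have hp' : ∀ t, p.eval t = complexExt m ![e, a, b] ![0, t, 1] := by
    intro t
    rw [hp]
    simp
  have hpr : ∀ t : ℝ, p.eval (t : ℂ) = P (t • a + b) := by
    intro t
    have := complexExt_triple_ofReal hm (e := e) a b 0 t 1
    simpa [← hp'] using this
  have hc : p.coeff k = P a := by
    have := complexExt_triple_ofReal hm (e := e) a b 0 1 0
    simpa [← hcoeff] using this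
  have hPa := ne_zero_of_mem_cone ha
  have hc0 : p.coeff k ≠ 0 := by rw [hc]; exact_mod_cast hPa
  have hp0 : p ≠ 0 := by rintro rfl; simp at hc0
  have hk : p.natDegree = k := le_antisymm hdeg (le_natDegree_of_ne_zero hc0)
  have hs := IsAlgClosed.splits p
  have hroot : ∀ r ∈ p.roots, r.re < 0 ∧ (r.re : ℂ) = r := by
    intro r hr
    have hr0 : p.eval r = 0 := (mem_roots hp0).1 hr
    have him := hP.im_eq_zero_of_mem_cone hm ha ((hp' r).symm.trans hr0)
    have hre : (r.re : ℂ) = r := Complex.ext rfl (by simpa using him.symm)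
    refine ⟨?_, hre⟩
    rw [← hre, hpr] at hr0
    have hr0 : P (r.re • a + b) = 0 := by exact_mod_cast hr0
    by_contra! hle
    rcases hle.eq_or_lt with h | h
    · rw [← h, zero_smul, zero_add] at hr0
      exact ne_zero_of_mem_cone hb hr0
    · exact hP.add_ne_zero (hP.smul_mem_cone ha h) hb hr0
  have hlen : p.roots.toList.length = k := by
    rw [Multiset.length_toList, ← hk]
    exact hs.natDegree_eq_card_roots.symm
  refine ⟨fun i => -(p.roots.toList.get (i.cast hlen.symm)).re, fun i => ?_, fun t => ?_⟩
  · exact neg_pos.2 (hroot _ (Multiset.mem_toList.1 (List.get_mem _ _))).1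
  · have hev : p.eval (t : ℂ) = p.coeff k * (p.roots.map fun r => (t : ℂ) - r).prod := by
      conv_lhs => rw [hs.eq_prod_roots]
      rw [eval_mul, eval_C, eval_multiset_prod, Multiset.map_map, leadingCoeff, hk]
      simp
    have hprod : (p.roots.map fun r => (t : ℂ) - r).prod =
        ∏ i : Fin k, ((t : ℂ) - p.roots.toList.get (i.cast hlen.symm)) := by
      conv_lhs => rw [← p.roots.coe_toList]
      rw [Multiset.map_coe, Multiset.prod_coe, ← Fin.prod_univ_fun_getElem]
      exact (Fintype.prod_equiv (finCongr hlen.symm) _ _ fun i => rfl).symm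
    rw [hpr, hc, hprod] at hev
    apply Complex.ofReal_injective
    rw [hev, Complex.ofReal_mul, Complex.ofReal_prod]
    congr 1
    refine Finset.prod_congr rfl fun i _ => ?_
    rw [Complex.ofReal_add, Complex.ofReal_neg,
      (hroot _ (Multiset.mem_toList.1 (List.get_mem _ _))).2, sub_eq_add_neg]

theorem pos_of_mem_cone {a : V} (ha : a ∈ cone P e) : 0 < P a := by
  obtain ⟨μ, hμ, h⟩ := hP.exists_factorization hP.self_mem_cone ha
  have := h 0
  rw [zero_smul, zero_add] at this
  rw [this]
  exact mul_pos hP.pos (Finset.prod_pos fun i _ => by simpa using hμ i)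

end IsHyperbolic

end Garding

/-! ### Concavity of the `k`-th root -/

/-- AM-GM is applied to the numbers `1 / (1 + μ i)` and to the numbers `μ i / (1 + μ i)`; the two
arithmetic means add up to `1`. -/
theorem one_add_prod_rpow_le {k : ℕ} (hk : 1 ≤ k) {μ : Fin k → ℝ} (hμ : ∀ i, 0 < μ i) :
    1 + (∏ i, μ i) ^ (1 / (k : ℝ)) ≤ (∏ i, (1 + μ i)) ^ (1 / (k : ℝ)) := by
  have hk0 : (k : ℝ) ≠ 0 := by positivity
  have hw : ∑ _i : Fin k, 1 / (k : ℝ) = 1 := by simp [hk0]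
  have h1 : ∀ i, 0 < 1 + μ i := fun i => by linarith [hμ i]
  have amgm : ∀ f : Fin k → ℝ, (∀ i, 0 ≤ f i) →
      (∏ i, f i) ^ (1 / (k : ℝ)) ≤ ∑ i, 1 / (k : ℝ) * f i := fun f hf => by
    rw [← Real.finsetProd_rpow _ _ fun i _ => hf i]
    exact Real.geom_mean_le_arith_mean_weighted _ _ _ (fun _ _ => by positivity) hw fun i _ => hf i
  have hpos : 0 < (∏ i, (1 + μ i)) ^ (1 / (k : ℝ)) :=
    Real.rpow_pos_of_pos (Finset.prod_pos fun i _ => h1 i) _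
  have hA := amgm (fun i => 1 / (1 + μ i)) fun i => (one_div_pos.2 (h1 i)).le
  have hB := amgm (fun i => μ i / (1 + μ i)) fun i => (div_pos (hμ i) (h1 i)).le
  have hsum : ∑ i, 1 / (k : ℝ) * (1 / (1 + μ i)) + ∑ i, 1 / (k : ℝ) * (μ i / (1 + μ i)) = 1 := by
    rw [← Finset.sum_add_distrib]
    refine Eq.trans ?_ hw
    refine Finset.sum_congr rfl fun i _ => ?_
    rw [← mul_add, ← add_div, div_self (h1 i).ne', mul_one]
  rw [Finset.prod_div_distrib, Real.div_rpow (Finset.prod_nonneg fun _ _ => by norm_num)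
    (Finset.prod_nonneg fun i _ => (h1 i).le), Finset.prod_const_one, Real.one_rpow] at hA
  rw [Finset.prod_div_distrib, Real.div_rpow (Finset.prod_nonneg fun i _ => (hμ i).le)
    (Finset.prod_nonneg fun i _ => (h1 i).le)] at hB
  rw [← div_le_one hpos, add_div]
  linarith

variable {V : Type*} [AddCommGroup V] [Module ℝ V] {k : ℕ} {P : V → ℝ} {e : V}

namespace IsHyperbolic

theorem rpow_add_le (hP : IsHyperbolic k P e) (hk : 1 ≤ k) {a b : V} (ha : a ∈ cone P e)
    (hb : b ∈ cone P e) :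
    P a ^ (1 / (k : ℝ)) + P b ^ (1 / (k : ℝ)) ≤ P (a + b) ^ (1 / (k : ℝ)) := by
  obtain ⟨μ, hμ, h⟩ := hP.exists_factorization ha hb
  have hPa := hP.pos_of_mem_cone ha
  have h0 := h 0
  have h1 := h 1
  simp only [zero_smul, zero_add, one_smul] at h0 h1
  rw [h0, h1, Real.mul_rpow hPa.le (Finset.prod_nonneg fun i _ => (hμ i).le),
    Real.mul_rpow hPa.le (Finset.prod_nonneg fun i _ => by linarith [hμ i])]
  have := mul_le_mul_of_nonneg_left (one_add_prod_rpow_le hk hμ)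
    (Real.rpow_nonneg hPa.le (1 / (k : ℝ)))
  rwa [mul_add, mul_one] at this

theorem rpow_smul (hP : IsHyperbolic k P e) (hk : 1 ≤ k) {a : V} (ha : a ∈ cone P e) {c : ℝ}
    (hc : 0 ≤ c) : P (c • a) ^ (1 / (k : ℝ)) = c * P a ^ (1 / (k : ℝ)) := by
  rw [hP.homogeneous.map_smul, Real.mul_rpow (by positivity) (hP.pos_of_mem_cone ha).le, one_div,
    Real.pow_rpow_inv_natCast hc (by lia)]

theorem concaveOn_rpow (hP : IsHyperbolic k P e) (hk : 1 ≤ k) :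
    ConcaveOn ℝ (cone P e) fun x => P x ^ (1 / (k : ℝ)) := by
  refine concaveOn_iff_forall_pos.2 ⟨hP.convex_cone, fun a ha b hb s t hs ht _ => ?_⟩
  have := hP.rpow_add_le hk (hP.smul_mem_cone ha hs) (hP.smul_mem_cone hb ht)
  rwa [hP.rpow_smul hk ha hs.le, hP.rpow_smul hk hb ht.le] at this

end IsHyperbolic

/-! ### Averaging over the group -/

section Reynolds

variable {G : Type*} [Group G] {ρ : Representation ℝ G V}

theorem map_mem_cone (hfix : ∀ g, ρ g e = e) (hinv : ∀ g x, P (ρ g x) = P x) (g : G) {x : V}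
    (hx : x ∈ cone P e) : ρ g x ∈ cone P e := by
  intro μ hμ
  refine hx μ ?_
  rw [IsEigenvalue, ← hinv g, map_add, map_smul, hfix]
  exact hμ

variable [Fintype G]

theorem reynolds_apply (x : V) :
    reynolds ρ x = ∑ g : G, (1 / (Fintype.card G : ℝ)) • ρ g x := by
  simp [reynolds, Finset.smul_sum]

theorem sum_one_div_card : ∑ _g : G, 1 / (Fintype.card G : ℝ) = 1 := by
  simp

theorem IsHyperbolic.reynolds_mem_cone (hP : IsHyperbolic k P e) (hfix : ∀ g, ρ g e = e)
    (hinv : ∀ g x, P (ρ g x) = P x) {x : V} (hx : x ∈ cone P e) : reynolds ρ x ∈ cone P e := by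
  rw [reynolds_apply]
  exact hP.convex_cone.sum_mem (fun _ _ => by positivity) sum_one_div_card
    fun g _ => map_mem_cone hfix hinv g hx

theorem IsHyperbolic.rpow_le_rpow_reynolds (hP : IsHyperbolic k P e) (hk : 1 ≤ k)
    (hfix : ∀ g, ρ g e = e) (hinv : ∀ g x, P (ρ g x) = P x) {x : V} (hx : x ∈ cone P e) :
    P x ^ (1 / (k : ℝ)) ≤ P (reynolds ρ x) ^ (1 / (k : ℝ)) := by
  have := (hP.concaveOn_rpow hk).le_map_sum (t := Finset.univ)
    (w := fun _ : G => 1 / (Fintype.card G : ℝ)) (p := fun g => ρ g x)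
    (fun _ _ => by positivity) sum_one_div_card fun g _ => map_mem_cone hfix hinv g hx
  rw [← reynolds_apply] at this
  simpa only [hinv, ← Finset.sum_smul, sum_one_div_card, one_smul] using this

theorem IsHyperbolic.le_reynolds (hP : IsHyperbolic k P e) (hfix : ∀ g, ρ g e = e)
    (hinv : ∀ g x, P (ρ g x) = P x) {x : V} (hx : x ∈ cone P e) : P x ≤ P (reynolds ρ x) := by
  -- In degree `0` the `k`-th root is unavailable, but `P` is constant.
  rcases Nat.eq_zero_or_pos k with rfl | hk
  · obtain ⟨m, hm⟩ := hP.homogeneous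
    rw [hm, hm]
    exact le_of_eq (congrArg m (Subsingleton.elim _ _))
  · exact (Real.rpow_le_rpow_iff (hP.pos_of_mem_cone hx).le
      (hP.pos_of_mem_cone (hP.reynolds_mem_cone hfix hinv hx)).le (by positivity)).1
      (hP.rpow_le_rpow_reynolds hk hfix hinv hx)

end Reynolds

end HyperbolicPoly

theorem theorem3p9 {V : Type*} [AddCommGroup V] [Module ℝ V] (k : ℕ) (P : V → ℝ) (e : V)
    (hP : HyperbolicPoly.IsHyperbolic k P e)
    {G : Type*} [Group G] [Fintype G] (ρ : Representation ℝ G V)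
    (hfix : ∀ g : G, ρ g e = e)
    (hinv : ∀ (g : G) (x : V), P (ρ g x) = P x) :
    (∀ x ∈ HyperbolicPoly.cone P e,
      (∀ g : G, ρ g x ∈ HyperbolicPoly.cone P e) ∧
      HyperbolicPoly.reynolds ρ x ∈ HyperbolicPoly.cone P e ∧
      P x ≤ P (HyperbolicPoly.reynolds ρ x)) ∧
    (1 ≤ k →
      ConcaveOn ℝ (HyperbolicPoly.cone P e) (fun x => P x ^ (1 / (k : ℝ))) ∧
      ∀ x ∈ HyperbolicPoly.cone P e,
        P x ^ (1 / (k : ℝ)) ≤ P (HyperbolicPoly.reynolds ρ x) ^ (1 / (k : ℝ))) := by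
  refine ⟨fun x hx => ⟨fun g => HyperbolicPoly.map_mem_cone hfix hinv g hx,
    hP.reynolds_mem_cone hfix hinv hx, hP.le_reynolds hfix hinv hx⟩, fun hk =>
    ⟨hP.concaveOn_rpow hk, fun x hx => hP.rpow_le_rpow_reynolds hk hfix hinv hx⟩⟩
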